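/- For a finite collection $\mathcal F$ of homogeneous polynomials with complex coefficients in fixed variables, the simultaneous Waring rank $\mathrm{rk}_{\mathbb C}\,\mathcal F$ is the least $r$ such that there are linear forms $L_1,\dots,L_r$ with the property that every $F\in\mathcal F$ can be written as $F=\sum_{j=1}^r\lambda_j L_j^{\deg F}$ with $\lambda_j\in\mathbb C$ (depending on $F$); put $\mathrm{rk}_{\mathbb C}\,F=\mathrm{rk}_{\mathbb C}\{F\}$. **Theorem.** Let $s,r,\ell\ge 0$, and in the polynomial ring $\mathbb C[x_0,y_1,\dots,y_s,z_1,\dots,z_r,t_1,\dots,t_\ell]$ let $$M_1=x_0\,y_1^{a_1}\cdots y_s^{a_s}\,z_1^{b_1}\cdots z_r^{b_r},\qquad M_2=x_0\,y_1^{c_1}\cdots y_s^{c_s}\,t_1^{d_1}\cdots t_\ell^{d_\ell},$$ where all $b_i,d_i\ge 2$ and all $a_i,c_i\ge 0$, and where no variable $y_i$ occurs in exactly one of the two monomials with exponent $1$ (that is, $\{a_i,c_i\}\ne\{0,1\}$ for every $i$). Let $M_{12}$ be a greatest common divisor of $M_1$ and $M_2$. Then $$\mathrm{rk}_{\mathbb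 C}\{M_1,M_2\}=\mathrm{rk}_{\mathbb C}\,M_1+\mathrm{rk}_{\mathbb C}\,M_2-\mathrm{rk}_{\mathbb C}\,M_{12}.$$ In particular, if $s=0$, so that $M_1=x_0z_1^{b_1}\cdots z_r^{b_r}$ and $M_2=x_0t_1^{d_1}\cdots t_\ell^{d_\ell}$ have only $x_0$ in common, then $$\mathrm{rk}_{\mathbb C}\{M_1,M_2\}=\mathrm{rk}_{\mathbb C}\,M_1+\mathrm{rk}_{\mathbb C}\,M_2-1.$$ -/

import Mathlib

open MvPolynomial

/-- `L₁, …, L_r` are linear forms such that every member `F` of the collection `𝓕` can be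
written as `F = ∑ j, lam j • (L j) ^ (deg F)` with complex coefficients `lam j` depending on `F`. -/
def SimultaneouslyDecomposes {σ : Type*} {r : ℕ} (L : Fin r → MvPolynomial σ ℂ)
    (𝓕 : Set (MvPolynomial σ ℂ)) : Prop :=
  (∀ j, (L j).IsHomogeneous 1) ∧
    ∀ F ∈ 𝓕, ∃ lam : Fin r → ℂ, F = ∑ j, lam j • L j ^ F.totalDegree

/-- The simultaneous Waring rank over `ℂ` of a collection of forms: the least `r` such that some
`r` linear forms decompose all members simultaneously. (Over `ℂ` every form is a linear combination
of powers of linear forms, so for a finite collection of forms such an `r` exists.) -/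
noncomputable def simRank {σ : Type*} (𝓕 : Set (MvPolynomial σ ℂ)) : ℕ :=
  sInf {r : ℕ | ∃ L : Fin r → MvPolynomial σ ℂ, SimultaneouslyDecomposes L 𝓕}

/-- The complex Waring rank of a single form. -/
noncomputable def waringRank {σ : Type*} (F : MvPolynomial σ ℂ) : ℕ :=
  simRank {F}

/-- `G` is a greatest common divisor of `A` and `B`; over `ℂ` it is unique up to a nonzero scalar. -/
def IsGreatestCommonDivisor {σ : Type*} (G A B : MvPolynomial σ ℂ) : Prop :=
  G ∣ A ∧ G ∣ B ∧ ∀ D : MvPolynomial σ ℂ, D ∣ A → D ∣ B → D ∣ G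

/-- The set of variables `x₀, y₁, …, y_s, z₁, …, z_r, t₁, …, t_l`. -/
abbrev Var (s r l : ℕ) : Type := Option (Fin s ⊕ Fin r ⊕ Fin l)

namespace Var

/-- The variable `x₀`. -/
def x₀ {s r l : ℕ} : Var s r l := none

/-- The variables `y_i`. -/
def y {s r l : ℕ} (i : Fin s) : Var s r l := some (Sum.inl i)

/-- The variables `z_i`. -/
def z {s r l : ℕ} (i : Fin r) : Var s r l := some (Sum.inr (Sum.inl i))

/-- The variables `t_i`. -/
def t {s r l : ℕ} (i : Fin l) : Var s r l := some (Sum.inr (Sum.inr i))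

end Var

/-! ### Linear forms and powers -/

/-! Comparing coefficients, linear forms with coefficient vectors `p j` decompose a monomial exactly
when a weighted sum of evaluations at the `p j` is dual to it among the monomials of its degree
(`exists_linearMonomial_eq_sum_pow_iff`). Both bounds come from this duality; put x₀ = 1 and let α,
γ be the remaining exponents.

Lower bound (`card_le_card_of_isDualMeasure`): the x^e with e ≤ α or e ≤ γ, homogenized by x₀, stay
independent on the points. Inclusion-exclusion counts these e as ∏(αᵢ+1) + ∏(γᵢ+1) -
∏(min(αᵢ,γᵢ)+1).

Upper bound (`exists_isDualMeasure`): a union of two grids ∏ Aᵢ ∪ ∏ Bᵢ has that many points when Aᵢ,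
Bᵢ are nested of sizes αᵢ+1, γᵢ+1. If every node set sums to zero, products of divided differences
are dual measures. Such nested sets exist unless the exponents are {0,1}.

For α = γ this gives the rank of one monomial, hence of the gcd. -/

theorem eq_sum_smul_X_of_isHomogeneous_one {σ R : Type*} [Fintype σ] [CommSemiring R]
    {L : MvPolynomial σ R} (hL : L.IsHomogeneous 1) :
    L = ∑ i, coeff (Finsupp.single i 1) L • X i := by
  classical
  ext m
  simp only [coeff_sum, coeff_smul, coeff_X, smul_eq_mul, mul_ite, mul_one, mul_zero]
  by_cases hm : m.degree = 1
  · obtain ⟨i, rfl⟩ := (Finsupp.sum_eq_one_iff m).mp hm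
    rw [Finset.sum_eq_single i] <;> simp +contextual [Finsupp.single_left_inj]
  · rw [hL.coeff_eq_zero hm, Finset.sum_eq_zero]
    intro i _
    rw [if_neg]
    rintro rfl
    simp at hm

theorem isHomogeneous_sum_smul_X {σ R : Type*} [Fintype σ] [CommSemiring R] (p : σ → R) :
    (∑ i, p i • X i : MvPolynomial σ R).IsHomogeneous 1 :=
  IsHomogeneous.sum _ _ _ fun i _ => by
    rw [smul_eq_C_mul]; exact isHomogeneous_C_mul_X _ _

theorem Finsupp.multinomial_ne_zero {σ : Type*} (m : σ →₀ ℕ) : m.multinomial ≠ 0 := by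
  rw [Finsupp.multinomial_eq]
  exact (Nat.multinomial_pos _ _).ne'

/-- A monomial is a linear combination of powers of given linear forms if and only if some
discrete signed measure on their coefficient vectors has the corresponding moments. -/
theorem exists_monomial_eq_sum_pow_iff {σ κ : Type*} [Fintype σ] [Fintype κ] [DecidableEq σ]
    (p : κ → σ → ℂ) (m₀ : σ →₀ ℕ) :
    (∃ lam : κ → ℂ, (monomial m₀ 1 : MvPolynomial σ ℂ) =
      ∑ j, lam j • (∑ i, p j i • X i) ^ m₀.degree) ↔
    ∃ lam : κ → ℂ, ∀ m : σ →₀ ℕ, m.degree = m₀.degree →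
      ∑ j, lam j * ∏ i, p j i ^ m i = if m = m₀ then 1 else 0 := by
  have key : ∀ lam : κ → ℂ, ∀ m : σ →₀ ℕ,
      coeff m (∑ j, lam j • (∑ i, p j i • X i : MvPolynomial σ ℂ) ^ m₀.degree) =
        if m.degree = m₀.degree then
          (m.multinomial : ℂ) * ∑ j, lam j * ∏ i, p j i ^ m i else 0 := by
    intro lam m
    simp only [coeff_sum, coeff_smul, coeff_linearCombination_X_pow_of_fintype, smul_eq_mul]
    change ∑ j, lam j * (if m.degree = _ then _ else _) = _
    split_ifs with h
    · rw [Finset.mul_sum]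
      refine Finset.sum_congr rfl fun j _ => ?_
      rw [Finsupp.prod_fintype _ _ (by simp)]
      ring
    · simp
  have h0 : (m₀.multinomial : ℂ) ≠ 0 := by exact_mod_cast m₀.multinomial_ne_zero
  constructor
  · rintro ⟨lam, h⟩
    -- Coefficients of a power of a linear form carry a nonzero multinomial factor; only the one at
    -- `m₀` affects the normalization.
    refine ⟨fun j => m₀.multinomial * lam j, fun m hm => ?_⟩
    have hk := key lam m
    rw [← h, coeff_monomial, if_pos hm] at hk
    simp only [mul_assoc, ← Finset.mul_sum]
    have hmm : (m.multinomial : ℂ) ≠ 0 := by exact_mod_cast m.multinomial_ne_zero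
    by_cases hmm₀ : m = m₀
    · subst hmm₀
      simpa using hk.symm
    · rw [if_neg (Ne.symm hmm₀)] at hk
      rw [if_neg hmm₀]
      rw [(mul_eq_zero.mp hk.symm).resolve_left hmm, mul_zero]
  · rintro ⟨lam, h⟩
    refine ⟨fun j => (m₀.multinomial : ℂ)⁻¹ * lam j, ?_⟩
    ext m
    rw [key, coeff_monomial]
    simp only [mul_assoc, ← Finset.mul_sum]
    by_cases hm : m.degree = m₀.degree
    · rw [if_pos hm, h m hm]
      by_cases hmm₀ : m = m₀
      · subst hmm₀
        simp [h0]
      · simp [hmm₀, Ne.symm hmm₀]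
    · rw [if_neg hm, if_neg]
      rintro rfl
      exact hm rfl

/-! ### Monomials that are linear in a distinguished variable -/

/-- The exponent vector with value `k` at `none` and values `e` elsewhere. -/
noncomputable def optionExponent {ι : Type*} [Finite ι] (k : ℕ) (e : ι → ℕ) : Option ι →₀ ℕ :=
  Finsupp.equivFunOnFinite.symm fun o => o.elim k e

section
variable {ι : Type*} [Fintype ι]

@[simp] theorem optionExponent_none (k : ℕ) (e : ι → ℕ) : optionExponent k e none = k := rfl

@[simp] theorem optionExponent_some (k : ℕ) (e : ι → ℕ) (i : ι) :
    optionExponent k e (some i) = e i := rfl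

theorem degree_optionExponent (k : ℕ) (e : ι → ℕ) :
    (optionExponent k e).degree = k + ∑ i, e i := by
  simp [Finsupp.degree_eq_sum, Fintype.sum_option]

/-- The monomial `x₀ * ∏ i, x_i ^ α i`. -/
noncomputable def linearMonomial (α : ι → ℕ) : MvPolynomial (Option ι) ℂ :=
  monomial (optionExponent 1 α) 1

theorem totalDegree_linearMonomial (α : ι → ℕ) :
    (linearMonomial α).totalDegree = (optionExponent 1 α).degree :=
  totalDegree_monomial _ one_ne_zero

/-- The functional `∑ j, lam j • (evaluation at p j)` takes the value `1` at the monomial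
`x₀ * x ^ α` and vanishes at all other monomials of the same degree. -/
def IsDualMeasure {κ : Type*} [Fintype κ] (p : κ → Option ι → ℂ) (lam : κ → ℂ) (α : ι → ℕ) :
    Prop :=
  ∀ (k : ℕ) (e : ι → ℕ), k + ∑ i, e i = 1 + ∑ i, α i →
    ((e = α → ∑ j, lam j * (p j none ^ k * ∏ i, p j (some i) ^ e i) = 1) ∧
      (e ≠ α → ∑ j, lam j * (p j none ^ k * ∏ i, p j (some i) ^ e i) = 0))

theorem exists_linearMonomial_eq_sum_pow_iff {κ : Type*} [Fintype κ] (p : κ → Option ι → ℂ)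
    (α : ι → ℕ) :
    (∃ lam : κ → ℂ, linearMonomial α =
      ∑ j, lam j • (∑ i, p j i • X i) ^ (linearMonomial α).totalDegree) ↔
    ∃ lam : κ → ℂ, IsDualMeasure p lam α := by
  classical
  rw [totalDegree_linearMonomial, linearMonomial, exists_monomial_eq_sum_pow_iff]
  refine exists_congr fun lam => ⟨fun h k e hke => ?_, fun h m hm => ?_⟩
  · have := h (optionExponent k e) (by simpa [degree_optionExponent] using hke)
    simp only [Fintype.prod_option, optionExponent_none, optionExponent_some] at this
    rw [this]
    constructor
    · rintro rfl
      obtain rfl : k = 1 := by simpa using hke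
      simp
    · intro hne
      rw [if_neg]
      intro heq
      apply hne
      ext i
      simpa using DFunLike.congr_fun heq (some i)
  · have hm' : m = optionExponent (m none) (fun i => m (some i)) := by
      ext (_ | i) <;> rfl
    have hd := hm
    rw [hm', degree_optionExponent, degree_optionExponent] at hd
    have := h _ _ hd
    simp only [Fintype.prod_option]
    split_ifs with hmα
    · exact this.1 (by ext i; simp [hmα])
    · refine this.2 fun he => hmα ?_
      subst he
      have : m none = 1 := by simpa using hd
      ext (_ | i)
      · simpa using this
      · rfl

/-! ### The lower bound -/

/-- In a linear relation, a term of top degree is isolated by multiplying by the monomial that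
completes it to `α` and applying the dual measure. -/
theorem card_le_card_of_isDualMeasure {κ : Type*} [Fintype κ] (p : κ → Option ι → ℂ)
    (E : Finset (ι → ℕ))
    (hE : ∀ e ∈ E, ∃ α, e ≤ α ∧ ∃ lam : κ → ℂ, IsDualMeasure p lam α) :
    E.card ≤ Fintype.card κ := by
  classical
  let N := E.sup fun e => ∑ i, e i
  let v : E → κ → ℂ := fun e j =>
    p j none ^ (N + 1 - ∑ i, e.1 i) * ∏ i, p j (some i) ^ e.1 i
  have hv : LinearIndependent ℂ v := by
    rw [Fintype.linearIndependent_iff]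
    intro c hc
    by_contra! hne
    have hS : (Finset.univ.filter fun e : E => c e ≠ 0).Nonempty := by
      obtain ⟨e, he⟩ := hne
      exact ⟨e, by simpa using he⟩
    obtain ⟨e₀, he₀, hmax⟩ := Finset.exists_max_image _ (fun e : E => ∑ i, e.1 i) hS
    rw [Finset.mem_filter] at he₀
    replace hmax : ∀ e : E, c e ≠ 0 → ∑ i, e.1 i ≤ ∑ i, e₀.1 i :=
      fun e he => hmax e (by simpa using he)
    obtain ⟨α, hα, lam, hlam⟩ := hE e₀.1 e₀.2
    set k := ∑ i, e₀.1 i with hk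
    have hkN : k ≤ N := Finset.le_sup (f := fun e : ι → ℕ => ∑ i, e i) e₀.2
    -- A surplus power of x₀ can be cancelled: where x₀ = 0 every term still vanishes, its
    -- x₀-exponent being at least 1.
    have hvan : ∀ j, ∑ e : E, c e * (p j none ^ (k + 1 - ∑ i, e.1 i) *
        ∏ i, p j (some i) ^ e.1 i) = 0 := by
      intro j
      have hj := congrFun hc j
      simp only [Finset.sum_apply, Pi.smul_apply, smul_eq_mul, Pi.zero_apply, v] at hj
      by_cases h0 : p j none = 0
      · refine Finset.sum_eq_zero fun e _ => ?_
        by_cases hce : c e = 0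
        · simp [hce]
        · have := hmax e hce
          rw [h0, zero_pow (by omega)]
          simp
      · have : p j none ^ (N - k) * ∑ e : E, c e * (p j none ^ (k + 1 - ∑ i, e.1 i) *
            ∏ i, p j (some i) ^ e.1 i) = 0 := by
          rw [← hj, Finset.mul_sum]
          refine Finset.sum_congr rfl fun e _ => ?_
          by_cases hce : c e = 0
          · simp [hce]
          · have := hmax e hce
            rw [show N + 1 - ∑ i, e.1 i = (N - k) + (k + 1 - ∑ i, e.1 i) by omega, pow_add]
            ring
        exact (mul_eq_zero.mp this).resolve_left (pow_ne_zero _ h0)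
    have hsum : ∑ e : E, c e * ∑ j, lam j * (p j none ^ (k + 1 - ∑ i, e.1 i) *
        ∏ i, p j (some i) ^ (e.1 + (α - e₀.1)) i) = 0 := by
      calc _ = ∑ j, (lam j * ∏ i, p j (some i) ^ (α - e₀.1) i) *
            ∑ e : E, c e * (p j none ^ (k + 1 - ∑ i, e.1 i) * ∏ i, p j (some i) ^ e.1 i) := by
            simp only [Finset.mul_sum]
            rw [Finset.sum_comm]
            refine Finset.sum_congr rfl fun j _ => Finset.sum_congr rfl fun e _ => ?_
            simp only [Pi.add_apply, pow_add, Finset.prod_mul_distrib]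
            ring
        _ = 0 := Finset.sum_eq_zero fun j _ => by rw [hvan j, mul_zero]
    have hdeg : ∑ i, α i = k + ∑ i, (α - e₀.1) i := by
      rw [hk, ← Finset.sum_add_distrib]
      refine Finset.sum_congr rfl fun i _ => ?_
      have : e₀.1 i ≤ α i := hα i
      simp only [Pi.sub_apply]
      omega
    have hfix : ∀ e : E, c e ≠ 0 →
        (k + 1 - ∑ i, e.1 i) + ∑ i, (e.1 + (α - e₀.1)) i = 1 + ∑ i, α i := by
      intro e he
      have := hmax e he
      simp only [Pi.add_apply, Finset.sum_add_distrib]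
      omega
    have hα' : e₀.1 + (α - e₀.1) = α := add_tsub_cancel_of_le hα
    rw [Finset.sum_eq_single e₀, (hlam _ _ (hfix e₀ he₀.2)).1 hα', mul_one] at hsum
    · exact he₀.2 hsum
    · intro e _ hne'
      by_cases hce : c e = 0
      · simp [hce]
      · rw [(hlam _ _ (hfix e hce)).2, mul_zero]
        intro h
        exact hne' (Subtype.ext (add_right_cancel (h.trans hα'.symm)))
    · simp
  simpa using hv.fintype_card_le_finrank

end

/-! ### Nested centred point sets on a line -/

theorem exists_finset_card_eq_sum_eq_zero_disjoint (T : Finset ℂ) {k : ℕ} (hk : 2 ≤ k) :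
    ∃ D : Finset ℂ, D.card = k ∧ ∑ u ∈ D, u = 0 ∧ Disjoint D T := by
  classical
  have hζ : IsPrimitiveRoot (Complex.exp (2 * Real.pi * Complex.I / k)) k :=
    Complex.isPrimitiveRoot_exp k (by omega)
  set ζ := Complex.exp (2 * Real.pi * Complex.I / k)
  have hζ1 : ‖ζ‖ = 1 := hζ.norm'_eq_one (by omega)
  -- A radius larger than every norm in `T` makes the scaled roots of unity avoid `T`.
  set w : ℝ := 1 + ∑ u ∈ T, ‖u‖ with hw
  have hT : 0 ≤ ∑ u ∈ T, ‖u‖ := Finset.sum_nonneg fun _ _ => norm_nonneg _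
  have hw0 : (w : ℂ) ≠ 0 := by
    have : w ≠ 0 := by linarith
    exact_mod_cast this
  have hinj : Set.InjOn (fun i => (w : ℂ) * ζ ^ i) (Finset.range k) := by
    intro i hi j hj h
    exact hζ.pow_inj (by simpa using hi) (by simpa using hj) (mul_left_cancel₀ hw0 h)
  refine ⟨(Finset.range k).image fun i => (w : ℂ) * ζ ^ i, ?_, ?_, ?_⟩
  · rw [Finset.card_image_of_injOn hinj, Finset.card_range]
  · rw [Finset.sum_image hinj, ← Finset.mul_sum, hζ.geom_sum_eq_zero (by omega), mul_zero]
  · rw [Finset.disjoint_left]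
    intro u hu huT
    obtain ⟨i, -, rfl⟩ := Finset.mem_image.mp hu
    have h1 := Finset.single_le_sum (f := fun u : ℂ => ‖u‖) (fun _ _ => norm_nonneg _) huT
    simp only [norm_mul, norm_pow, hζ1, one_pow, mul_one, Complex.norm_real, Real.norm_eq_abs]
      at h1
    linarith [le_abs_self w]

/-- A centred set grows by 0 or by a centred block of at least two points. Only {0} cannot grow by
exactly one, since the new point would have to be a second 0. -/
theorem exists_nested_finset_sum_eq_zero {m n : ℕ} (hmn : m ≤ n) (h : m = 0 → n ≠ 1) :
    ∃ A B : Finset ℂ, A ⊆ B ∧ A.card = m + 1 ∧ B.card = n + 1 ∧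
      ∑ u ∈ A, u = 0 ∧ ∑ u ∈ B, u = 0 := by
  classical
  obtain ⟨A, hA, hA0, h0⟩ : ∃ A : Finset ℂ, A.card = m + 1 ∧ ∑ u ∈ A, u = 0 ∧
      (1 ≤ m → (0 : ℂ) ∉ A) := by
    rcases Nat.eq_zero_or_pos m with rfl | hm
    · exact ⟨{0}, by simp⟩
    · obtain ⟨D, hD, hD0, hdisj⟩ :=
        exists_finset_card_eq_sum_eq_zero_disjoint {0} (k := m + 1) (by omega)
      exact ⟨D, hD, hD0, fun _ => by simpa using hdisj⟩
  obtain rfl | rfl | hlt : n = m ∨ n = m + 1 ∨ m + 2 ≤ n := by omega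
  · exact ⟨A, A, subset_rfl, hA, hA, hA0, hA0⟩
  · have := h0 (by omega)
    exact ⟨A, insert 0 A, Finset.subset_insert _ _, hA, by simp [this, hA], hA0,
      by simp [this, hA0]⟩
  · obtain ⟨D, hD, hD0, hdisj⟩ :=
      exists_finset_card_eq_sum_eq_zero_disjoint A (k := n - m) (by omega)
    refine ⟨A, A ∪ D, Finset.subset_union_left, hA, ?_, hA0, ?_⟩
    · rw [Finset.card_union_of_disjoint hdisj.symm]
      omega
    · rw [Finset.sum_union hdisj.symm, hA0, hD0, add_zero]

theorem exists_finset_sum_eq_zero_card_inter {m n : ℕ}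
    (h : (n = 0 → m ≠ 1) ∧ (m = 0 → n ≠ 1)) :
    ∃ A B : Finset ℂ, A.card = m + 1 ∧ B.card = n + 1 ∧ (A ∩ B).card = min m n + 1 ∧
      ∑ u ∈ A, u = 0 ∧ ∑ u ∈ B, u = 0 := by
  rcases le_total m n with hmn | hmn
  · obtain ⟨A, B, hs, hA, hB, hA0, hB0⟩ := exists_nested_finset_sum_eq_zero hmn h.2
    exact ⟨A, B, hA, hB, by rw [Finset.inter_eq_left.mpr hs, hA, min_eq_left hmn], hA0, hB0⟩
  · obtain ⟨B, A, hs, hB, hA, hB0, hA0⟩ := exists_nested_finset_sum_eq_zero hmn h.1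
    exact ⟨A, B, hA, hB, by rw [Finset.inter_eq_right.mpr hs, hB, min_eq_right hmn], hA0, hB0⟩

/-- The divided difference on a centred set of `n + 1` nodes. -/
theorem exists_weights_sum_pow {A : Finset ℂ} {n : ℕ} (hA : A.card = n + 1)
    (hA0 : ∑ u ∈ A, u = 0) :
    ∃ w : ℂ → ℂ, (∀ i < n, ∑ u ∈ A, w u * u ^ i = 0) ∧ ∑ u ∈ A, w u * u ^ n = 1 ∧
      ∑ u ∈ A, w u * u ^ (n + 1) = 0 := by
  classical
  have hev : ∀ P : Polynomial ℂ, P.degree < (n + 1 : ℕ) →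
      ∑ u ∈ A, (∏ v ∈ A.erase u, (u - v))⁻¹ * P.eval u = P.coeff n := by
    intro P hP
    have := Lagrange.coeff_eq_sum (s := A) (v := id) (P := P) (Set.injOn_id _) (by rw [hA]; exact hP)
    rw [hA, Nat.add_sub_cancel] at this
    rw [this]
    refine Finset.sum_congr rfl fun u _ => ?_
    simp [div_eq_inv_mul]
  refine ⟨fun u => (∏ v ∈ A.erase u, (u - v))⁻¹, fun i hi => ?_, ?_, ?_⟩
  · have := hev (Polynomial.X ^ i) (by
      rw [Polynomial.degree_X_pow]; exact_mod_cast (by omega : i < n + 1))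
    simpa [Polynomial.coeff_X_pow, hi.ne'] using this
  · have := hev (Polynomial.X ^ n) (by
      rw [Polynomial.degree_X_pow]; exact_mod_cast (by omega : n < n + 1))
    simpa using this
  -- On `A`, X^(n+1) agrees with X^(n+1) - Q, of degree at most n; its X^n coefficient is the sum of
  -- the nodes, which is 0.
  · set Q : Polynomial ℂ := ∏ u ∈ A, (Polynomial.X - Polynomial.C u) with hQ
    have hQm : Q.Monic := Polynomial.monic_prod_X_sub_C (fun u => u) A
    have hQd : Q.degree = (n + 1 : ℕ) := by
      rw [hQ, Polynomial.degree_prod]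
      simp [hA]
    have hQc : Q.coeff n = 0 := by
      have := Polynomial.prod_X_sub_C_coeff_card_pred A (fun u : ℂ => u) (by omega)
      rwa [hA, hA0, neg_zero, Nat.add_sub_cancel] at this
    have hdeg : (Polynomial.X ^ (n + 1) - Q : Polynomial ℂ).degree < ((n + 1 : ℕ) : WithBot ℕ) := by
      have := Polynomial.degree_sub_lt_left (p := Polynomial.X ^ (n + 1)) (q := Q)
        (by rw [hQd, Polynomial.degree_X_pow]) (by simp)
        (by rw [hQm.leadingCoeff, Polynomial.leadingCoeff_X_pow])
      rwa [Polynomial.degree_X_pow] at this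
    have := hev _ hdeg
    rw [Polynomial.coeff_sub, hQc, Polynomial.coeff_X_pow, if_neg (by omega), sub_zero] at this
    rw [← this]
    refine Finset.sum_congr rfl fun u hu => ?_
    have : Q.eval u = 0 := by
      rw [hQ, Polynomial.eval_prod]
      exact Finset.prod_eq_zero hu (by simp)
    simp [this]

/-! ### The upper bound -/

section
variable {ι : Type*} [Fintype ι]

theorem IsDualMeasure.comp_equiv {κ κ' : Type*} [Fintype κ] [Fintype κ']
    {p : κ → Option ι → ℂ} {lam : κ → ℂ} {α : ι → ℕ} (h : IsDualMeasure p lam α) (e : κ' ≃ κ) :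
    IsDualMeasure (fun j => p (e j)) (lam ∘ e) α := by
  intro k m hkm
  have := e.sum_comp fun j => lam j * (p j none ^ k * ∏ i, p j (some i) ^ m i)
  simp only [Function.comp_apply, this]
  exact h k m hkm

theorem exists_isDualMeasure [DecidableEq ι] (A : ι → Finset ℂ) (α : ι → ℕ)
    (hA : ∀ i, (A i).card = α i + 1) (hA0 : ∀ i, ∑ u ∈ A i, u = 0)
    (S : Finset (ι → ℂ)) (hS : Fintype.piFinset A ⊆ S) :
    ∃ lam : S → ℂ, IsDualMeasure (fun (q : S) (o : Option ι) => o.elim 1 q.1) lam α := by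
  classical
  choose w hw0 hw1 hw2 using fun i => exists_weights_sum_pow (hA i) (hA0 i)
  refine ⟨fun q => if q.1 ∈ Fintype.piFinset A then ∏ i, w i (q.1 i) else 0, fun k e hke => ?_⟩
  have hsum : ∑ q : S, (if q.1 ∈ Fintype.piFinset A then ∏ i, w i (q.1 i) else 0) *
      ((1 : ℂ) ^ k * ∏ i, q.1 i ^ e i) = ∏ i, ∑ u ∈ A i, w i u * u ^ e i := by
    rw [Finset.prod_univ_sum, Finset.sum_coe_sort S fun q =>
      (if q ∈ Fintype.piFinset A then ∏ i, w i (q i) else 0) * ((1 : ℂ) ^ k * ∏ i, q i ^ e i),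
      ← Finset.sum_subset hS]
    · refine Finset.sum_congr rfl fun q hq => ?_
      rw [if_pos hq, one_pow, one_mul, Finset.prod_mul_distrib]
    · intro q _ hq
      rw [if_neg hq, zero_mul]
  change (_ → ∑ q : S, _ * ((1 : ℂ) ^ k * ∏ i, q.1 i ^ e i) = 1) ∧
    (_ → ∑ q : S, _ * ((1 : ℂ) ^ k * ∏ i, q.1 i ^ e i) = 0)
  rw [hsum]
  constructor
  · rintro rfl
    exact Finset.prod_eq_one fun i _ => hw1 i
  · intro hne
    by_cases hlt : ∃ i, e i < α i
    · obtain ⟨i, hi⟩ := hlt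
      exact Finset.prod_eq_zero (Finset.mem_univ i) (hw0 i _ hi)
    · push Not at hlt
      obtain ⟨i, hi⟩ : ∃ i, e i ≠ α i := by
        by_contra! h
        exact hne (funext h)
      -- As e ≥ α and the degree is 1 + |α|, only one unit can be in excess; the centred nodes kill
      -- exactly this case.
      have hi1 : e i = α i + 1 := by
        have h1 : ∑ j ∈ Finset.univ.erase i, α j ≤ ∑ j ∈ Finset.univ.erase i, e j :=
          Finset.sum_le_sum fun j _ => hlt j
        have h2 := Finset.add_sum_erase Finset.univ e (Finset.mem_univ i)
        have h3 := Finset.add_sum_erase Finset.univ α (Finset.mem_univ i)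
        have := hlt i
        omega
      exact Finset.prod_eq_zero (Finset.mem_univ i) (by rw [hi1]; exact hw2 i)

/-! ### The simultaneous rank of two monomials -/

theorem simultaneouslyDecomposes_iff_isDualMeasure {r : ℕ} (p : Fin r → Option ι → ℂ)
    (α γ : ι → ℕ) :
    SimultaneouslyDecomposes (fun j => ∑ i, p j i • X i) {linearMonomial α, linearMonomial γ} ↔
      (∃ lam, IsDualMeasure p lam α) ∧ ∃ lam, IsDualMeasure p lam γ := by
  rw [← exists_linearMonomial_eq_sum_pow_iff, ← exists_linearMonomial_eq_sum_pow_iff]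
  have := fun j => isHomogeneous_sum_smul_X (p j)
  simp only [SimultaneouslyDecomposes, this, implies_true, true_and, Set.mem_insert_iff,
    Set.mem_singleton_iff, forall_eq_or_imp, forall_eq]

theorem simRank_linearMonomial_pair (α γ : ι → ℕ)
    (h : ∀ i, (γ i = 0 → α i ≠ 1) ∧ (α i = 0 → γ i ≠ 1)) :
    (simRank {linearMonomial α, linearMonomial γ} : ℤ) =
      ∏ i, ((α i : ℤ) + 1) + ∏ i, ((γ i : ℤ) + 1) - ∏ i, ((min (α i) (γ i) : ℕ) + 1 : ℤ) := by
  classical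
  choose A B hA hB hAB hA0 hB0 using fun i => exists_finset_sum_eq_zero_card_inter (h i)
  set S := Fintype.piFinset A ∪ Fintype.piFinset B with hSdef
  set E := Finset.Iic α ∪ Finset.Iic γ with hEdef
  have hE : (E.card : ℤ) =
      ∏ i, ((α i : ℤ) + 1) + ∏ i, ((γ i : ℤ) + 1) - ∏ i, ((min (α i) (γ i) : ℕ) + 1 : ℤ) := by
    have hI : Finset.Iic α ∩ Finset.Iic γ = Finset.Iic (α ⊓ γ) := by
      ext e
      simp
    have := Finset.card_union_add_card_inter (Finset.Iic α) (Finset.Iic γ)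
    rw [hI, Pi.card_Iic, Pi.card_Iic, Pi.card_Iic] at this
    simp only [Nat.card_Iic, Pi.inf_apply] at this
    rw [eq_sub_iff_add_eq]
    exact_mod_cast this
  have hSE : S.card = E.card := by
    have h1 := Finset.card_union_add_card_inter (Fintype.piFinset A) (Fintype.piFinset B)
    rw [← Fintype.piFinset_inter, Fintype.card_piFinset, Fintype.card_piFinset,
      Fintype.card_piFinset] at h1
    simp only [hA, hB, hAB] at h1
    zify at h1 ⊢
    rw [hE, hSdef, eq_sub_iff_add_eq]
    exact_mod_cast h1
  have hmem : ∃ L : Fin E.card → MvPolynomial (Option ι) ℂ,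
      SimultaneouslyDecomposes L {linearMonomial α, linearMonomial γ} := by
    obtain ⟨q, ⟨lam, hlam⟩, mu, hmu⟩ : ∃ q : S → Option ι → ℂ,
        (∃ lam, IsDualMeasure q lam α) ∧ ∃ mu, IsDualMeasure q mu γ :=
      ⟨_, exists_isDualMeasure A α hA hA0 S Finset.subset_union_left,
        exists_isDualMeasure B γ hB hB0 S Finset.subset_union_right⟩
    have e : Fin E.card ≃ S := (finCongr hSE.symm).trans S.equivFin.symm
    exact ⟨_, (simultaneouslyDecomposes_iff_isDualMeasure (fun j => q (e j)) α γ).mpr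
      ⟨⟨_, hlam.comp_equiv e⟩, _, hmu.comp_equiv e⟩⟩
  rw [← hE, Nat.cast_inj]
  refine le_antisymm (Nat.sInf_le hmem) (le_csInf ⟨_, hmem⟩ ?_)
  rintro r ⟨L, hL⟩
  obtain ⟨p, rfl⟩ : ∃ p : Fin r → Option ι → ℂ, L = fun j => ∑ i, p j i • X i :=
    ⟨_, funext fun j => eq_sum_smul_X_of_isHomogeneous_one (hL.1 j)⟩
  rw [simultaneouslyDecomposes_iff_isDualMeasure] at hL
  simpa using card_le_card_of_isDualMeasure p E fun e he => by
    rcases Finset.mem_union.mp he with he | he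
    · exact ⟨α, Finset.mem_Iic.mp he, hL.1⟩
    · exact ⟨γ, Finset.mem_Iic.mp he, hL.2⟩

/-- The pair formula on the diagonal: its exponent condition holds trivially and two of the three
equal products cancel. -/
theorem waringRank_linearMonomial (α : ι → ℕ) :
    (waringRank (linearMonomial α) : ℤ) = ∏ i, ((α i : ℤ) + 1) := by
  have := simRank_linearMonomial_pair α α fun i => ⟨fun h => by omega, fun h => by omega⟩
  simpa [waringRank] using this

/-! ### Greatest common divisors -/

theorem SimultaneouslyDecomposes.smul {σ : Type*} {r : ℕ} {L : Fin r → MvPolynomial σ ℂ}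
    {F : MvPolynomial σ ℂ} (h : SimultaneouslyDecomposes L {F}) {u : ℂ} (hu : u ≠ 0) :
    SimultaneouslyDecomposes L {u • F} := by
  refine ⟨h.1, fun G hG => ?_⟩
  rw [Set.mem_singleton_iff] at hG
  subst hG
  obtain ⟨lam, hlam⟩ := h.2 F rfl
  have hdeg : (u • F).totalDegree = F.totalDegree := by
    refine le_antisymm (totalDegree_smul_le _ _) ?_
    simpa [smul_smul, hu] using totalDegree_smul_le u⁻¹ (u • F)
  refine ⟨fun j => u * lam j, ?_⟩
  rw [hdeg]
  conv_lhs => rw [hlam]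
  rw [Finset.smul_sum]
  simp only [smul_smul]

theorem waringRank_smul {σ : Type*} (F : MvPolynomial σ ℂ) {u : ℂ} (hu : u ≠ 0) :
    waringRank (u • F) = waringRank F := by
  unfold waringRank simRank
  congr 1
  ext r
  refine exists_congr fun L => ⟨fun h => ?_, fun h => h.smul hu⟩
  simpa [smul_smul, hu] using h.smul (inv_ne_zero hu)

/-- Units of the polynomial ring are nonzero constants, so the choice of gcd does not affect the
rank. -/
theorem waringRank_eq_of_associated {σ : Type*} {F G : MvPolynomial σ ℂ} (h : Associated F G) :
    waringRank F = waringRank G := by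
  obtain ⟨u, rfl⟩ := h
  obtain ⟨v, hv, huv⟩ := isUnit_iff_eq_C_of_isReduced.mp u.isUnit
  rw [huv, mul_comm, ← smul_eq_C_mul, waringRank_smul _ hv.ne_zero]

theorem isGreatestCommonDivisor_linearMonomial (α γ : ι → ℕ) :
    IsGreatestCommonDivisor (linearMonomial (α ⊓ γ)) (linearMonomial α) (linearMonomial γ) := by
  have hdvd : ∀ {m n : Option ι →₀ ℕ}, m ≤ n →
      (monomial m (1 : ℂ)) ∣ monomial n (1 : ℂ) := fun {m n} hmn =>
    (dvd_monomial_iff_exists one_ne_zero).mpr ⟨m, 1, hmn, dvd_rfl, rfl⟩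
  refine ⟨hdvd ?_, hdvd ?_, fun D h₁ h₂ => ?_⟩
  · rintro (_ | i)
    · simp
    · simp
  · rintro (_ | i)
    · simp
    · simp
  · obtain ⟨m, b, hm, hb, rfl⟩ := (dvd_monomial_iff_exists one_ne_zero).mp h₁
    obtain ⟨m', b', hm', hb', heq⟩ := (dvd_monomial_iff_exists one_ne_zero).mp h₂
    have hb0 : b ≠ 0 := by
      rintro rfl
      simp at hb
    obtain ⟨rfl, -⟩ : m = m' ∧ b = b' :=
      ((monomial_eq_monomial_iff _ _ _ _).mp heq).resolve_right fun h => hb0 h.1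
    refine (dvd_monomial_iff_exists one_ne_zero).mpr ⟨m, b, ?_, hb, rfl⟩
    rintro (_ | i)
    · exact hm none
    · exact le_min (hm (some i)) (hm' (some i))

theorem IsGreatestCommonDivisor.associated {σ : Type*} {G G' A B : MvPolynomial σ ℂ}
    (h : IsGreatestCommonDivisor G A B) (h' : IsGreatestCommonDivisor G' A B) :
    Associated G G' :=
  associated_of_dvd_dvd (h'.2.2 G h.1 h.2.1) (h.2.2 G' h'.1 h'.2.1)

theorem linearMonomial_eq_prod (α : ι → ℕ) :
    linearMonomial α = X none * ∏ i, X (some i) ^ α i := by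
  rw [linearMonomial, monomial_eq, C_1, one_mul, Finsupp.prod_fintype _ _ (by simp),
    Fintype.prod_option]
  simp

end

theorem mainTheorem4 (s r l : ℕ) (a c : Fin s → ℕ) (b : Fin r → ℕ) (d : Fin l → ℕ)
    (hb : ∀ i, 2 ≤ b i) (hd : ∀ i, 2 ≤ d i)
    (hac : ∀ i, (c i = 0 → a i ≠ 1) ∧ (a i = 0 → c i ≠ 1))
    (M₁ M₂ M₁₂ : MvPolynomial (Var s r l) ℂ)
    (hM₁ : M₁ = X Var.x₀ * (∏ i, X (Var.y i) ^ a i) * ∏ i, X (Var.z i) ^ b i)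
    (hM₂ : M₂ = X Var.x₀ * (∏ i, X (Var.y i) ^ c i) * ∏ i, X (Var.t i) ^ d i)
    (hM₁₂ : IsGreatestCommonDivisor M₁₂ M₁ M₂) :
    ((simRank {M₁, M₂} : ℤ) = (waringRank M₁ : ℤ) + (waringRank M₂ : ℤ) - (waringRank M₁₂ : ℤ)) ∧
    (s = 0 → (simRank {M₁, M₂} : ℤ) = (waringRank M₁ : ℤ) + (waringRank M₂ : ℤ) - 1) := by
  let α : Fin s ⊕ Fin r ⊕ Fin l → ℕ := Sum.elim a (Sum.elim b 0)
  let γ : Fin s ⊕ Fin r ⊕ Fin l → ℕ := Sum.elim c (Sum.elim 0 d)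
  have h₁ : M₁ = linearMonomial α := by
    rw [hM₁, linearMonomial_eq_prod]
    simp [α, Var.x₀, Var.y, Var.z, mul_assoc]
  have h₂ : M₂ = linearMonomial γ := by
    rw [hM₂, linearMonomial_eq_prod]
    simp [γ, Var.x₀, Var.y, Var.t, mul_assoc]
  rw [h₁, h₂] at hM₁₂
  have h₁₂ := waringRank_eq_of_associated
    (hM₁₂.associated (isGreatestCommonDivisor_linearMonomial α γ))
  -- At zᵢ and tᵢ the exponent pairs are (bᵢ, 0) and (0, dᵢ); the bounds bᵢ, dᵢ ≥ 2 exclude {0,1}.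
  have hrank := simRank_linearMonomial_pair α γ (by
    rintro (i | i | i)
    · exact hac i
    · have := hb i
      simp only [α, γ, Sum.elim_inr, Sum.elim_inl, Pi.zero_apply]
      omega
    · have := hd i
      simp only [α, γ, Sum.elim_inr, Pi.zero_apply]
      omega)
  rw [h₁, h₂, h₁₂, waringRank_linearMonomial, waringRank_linearMonomial,
    waringRank_linearMonomial, hrank]
  refine ⟨rfl, ?_⟩
  rintro rfl
  simp [α, γ]
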